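/- A system $(X,S)$ is a non-empty compact metric space $X$ with a homeomorphism $S\colon X\to X$. It is minimal if its only closed $S$-invariant subsets are $\emptyset$ and $X$, Cantor (resp. zero-dimensional) if $X$ is a Cantor space (resp. zero-dimensional), and uniquely ergodic if there is exactly one $S$-invariant Borel probability measure on $X$. Its group of coinvariants is $\mathcal G_S=C(X,\mathbb Z)/\{f-f\circ S\}$. A state is a homomorphism $\tau\colon\mathcal G_S\to\mathbb R$ with $\tau([f])\ge 0$ for every $f\ge 0$ and $\tau([1])=1$; the subgroup of infinitesimals $\mathrm{Inf}_S\subset\mathcal G_S$ is the intersection of the kernels of all states. For a zero-dimensional system, states correspond bijectively to invariant Borel probability measures by integration, so a uniquely ergodic Cantor system has exactly one state. For a state $\tau$, $\mathrm{Im}(\tau)\otimes\mathbb Q$ is viewed as the $\mathbb Q$-linear span of $\mathrm{Im}(\tau)$ in $\mathbb R$. A factor map $\pi\colon(X,S)\to(Y,T)$ is a continuous surjection with $\pi S=T\pi$. Let $B\subset Y$ be the set of points with more than one preimage. The factor map $\pi$ is 2-asymptotic (2-A) if every $y\in B$ has exactly two preimages $x,x'$, and they are asymptotic: $d(S^nx,S^nx')\to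 0$ as $n\to-\infty$ and as $n\to+\infty$. Choosing one representative $y$ of every $T$-orbit in $B$ and an order $(x,x')$ on its fibre, the index homomorphism $\mathcal I\colon\mathcal G_S\to\prod_{B\bmod T}\mathbb Z$ has components $$\mathcal I_y([f])=\sum_{n\in\mathbb Z}\bigl(f(S^nx)-f(S^nx')\bigr),$$ where each sum has only finitely many nonzero terms. The 2-A factor map $\pi$ is infinitesimal (2-AI) if $\mathcal I(\mathcal G_S)/\mathcal I(\mathrm{Inf}_S)$ is a torsion group; this does not depend on the choices. Two zero-dimensional systems are elementary 2-AI equivalent if both are 2-AI factors of one zero-dimensional system, and 2-AI equivalence of zero-dimensional systems is the transitive closure of this relation (so all intermediate systems are zero-dimensional; they are not required to be minimal, Cantor or uniquely ergodic). **Corollary.** Let $(X,S)$ and $(Y,T)$ be uniquely ergodic minimal Cantor systems with states $\tau_X$ and $\tau_Y$. 1. If there exists a 2-AI factor map $\pi\colon(X,S)\to(Y,T)$, then $\mathrm{Im}(\tau_X)\otimes\mathbb Q=\mathrm{Im}(\tau_Y)\otimes\mathbb Q$. 2. If $\mathrm{Im}(\tau_X)\otimes\mathbb Q=\mathrm{Im}(\tau_Y)\otimes\mathbb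 Q$, then every 2-A factor map $\pi\colon(X,S)\to(Y,T)$ is infinitesimal. 3. If $(X,S)$ and $(Y,T)$ are 2-AI equivalent, then $\mathrm{Im}(\tau_X)\otimes\mathbb Q=\mathrm{Im}(\tau_Y)\otimes\mathbb Q$. -/

import Mathlib

open Filter Topology MeasureTheory

universe u

noncomputable section

/-- A (dynamical) system: a non-empty compact metric space with a self-homeomorphism. -/
structure DynSys : Type (u + 1) where
  carrier : Type u
  [metric : MetricSpace carrier]
  [compact : CompactSpace carrier]
  [nonempty : Nonempty carrier]
  map : carrier ≃ₜ carrier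

namespace DynSys

instance : CoeSort DynSys.{u} (Type u) := ⟨DynSys.carrier⟩
instance (X : DynSys.{u}) : MetricSpace X := X.metric
instance (X : DynSys.{u}) : CompactSpace X := X.compact
instance (X : DynSys.{u}) : Nonempty X := X.nonempty
instance (X : DynSys.{u}) : MeasurableSpace X := borel X
instance (X : DynSys.{u}) : BorelSpace X := ⟨rfl⟩

/-- The only closed invariant subsets are the empty set and the whole space. -/
def IsMinimal (X : DynSys.{u}) : Prop :=
  ∀ C : Set X, IsClosed C → X.map '' C = C → C = ∅ ∨ C = Set.univ

/-- The space is a Cantor space. -/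
def IsCantor (X : DynSys.{u}) : Prop := Nonempty (X ≃ₜ (ℕ → Bool))

/-- The clopen subsets form a basis of the topology. -/
def IsZeroDim (X : DynSys.{u}) : Prop :=
  TopologicalSpace.IsTopologicalBasis {U : Set X | IsClopen U}

/-- There is exactly one invariant Borel probability measure. -/
def IsUniquelyErgodic (X : DynSys.{u}) : Prop :=
  ∃! μ : Measure X, IsProbabilityMeasure μ ∧ μ.map X.map = μ

/-- The map `S`, as a continuous map. -/
def shift (X : DynSys.{u}) : C(X, X) := ⟨X.map, X.map.continuous⟩

/-- The coboundary homomorphism `f ↦ f - f ∘ S` on integer valued continuous functions. -/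
def coboundary (X : DynSys.{u}) : C(X, ℤ) →+ C(X, ℤ) where
  toFun f := f - f.comp X.shift
  map_zero' := by ext x; simp
  map_add' f g := by ext x; simp; ring

/-- The group of coinvariants `C(X, ℤ) / {f - f ∘ S}`. -/
abbrev Coinv (X : DynSys.{u}) : Type u := C(X, ℤ) ⧸ X.coboundary.range

/-- The class of a function in the group of coinvariants. -/
abbrev cls (X : DynSys.{u}) (f : C(X, ℤ)) : X.Coinv := QuotientAddGroup.mk f

/-- States: positive homomorphisms from the coinvariants to `ℝ` sending the class of `1` to `1`. -/
structure IsState (X : DynSys.{u}) (τ : X.Coinv →+ ℝ) : Prop where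
  nonneg : ∀ f : C(X, ℤ), (∀ x, 0 ≤ f x) → 0 ≤ τ (X.cls f)
  one : τ (X.cls 1) = 1

/-- The image of `τ` tensored with `ℚ`: as the image is a subgroup of `ℝ`, this is the
`ℚ`-linear subspace of `ℝ` that it generates. -/
def ratImage (X : DynSys.{u}) (τ : X.Coinv →+ ℝ) : Submodule ℚ ℝ :=
  Submodule.span ℚ (Set.range τ)

/-- The subgroup of infinitesimals: the classes on which every state vanishes. -/
def infinitesimals (X : DynSys.{u}) : AddSubgroup X.Coinv :=
  ⨅ τ : {τ : X.Coinv →+ ℝ // X.IsState τ}, τ.1.ker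

/-- Asymptotic points: `d(Sⁿ x, Sⁿ x') → 0` as `n → -∞` and as `n → +∞`. -/
def Asymptotic (X : DynSys.{u}) (x x' : X) : Prop :=
  Tendsto (fun n : ℤ => dist ((X.map ^ n) x) ((X.map ^ n) x')) atBot (𝓝 0) ∧
    Tendsto (fun n : ℤ => dist ((X.map ^ n) x) ((X.map ^ n) x')) atTop (𝓝 0)

/-- For an asymptotic pair, only finitely many terms of the index sum are nonzero. -/
lemma Asymptotic.finite_support {X : DynSys.{u}} {x x' : X} (h : X.Asymptotic x x')
    (f : C(X, ℤ)) :
    (Function.support fun n : ℤ => f ((X.map ^ n) x) - f ((X.map ^ n) x')).Finite := by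
  have huc : UniformContinuous f := CompactSpace.uniformContinuous_of_continuous f.continuous
  obtain ⟨δ, hδ, hf⟩ := Metric.uniformContinuous_iff.1 huc 1 one_pos
  have key : ∀ n : ℤ, dist ((X.map ^ n) x) ((X.map ^ n) x') < δ →
      f ((X.map ^ n) x) - f ((X.map ^ n) x') = 0 := by
    intro n hn
    have h1 := hf hn
    rw [Int.dist_eq] at h1
    have h2 : |f ((X.map ^ n) x) - f ((X.map ^ n) x')| < 1 := by exact_mod_cast h1
    exact Int.abs_lt_one_iff.1 h2
  obtain ⟨a, ha⟩ := eventually_atBot.1 (h.1.eventually (gt_mem_nhds hδ))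
  obtain ⟨b, hb⟩ := eventually_atTop.1 (h.2.eventually (gt_mem_nhds hδ))
  refine (Set.finite_Icc a b).subset fun n hn => ?_
  by_contra hcon
  rw [Set.mem_Icc, not_and_or, not_le, not_le] at hcon
  rcases hcon with hcon | hcon
  · exact hn (key n (ha n hcon.le))
  · exact hn (key n (hb n hcon.le))

/-- The homomorphism `f ↦ ∑ₙ (f(Sⁿ x) - f(Sⁿ x'))` of an asymptotic pair. -/
def pairIndexFun {X : DynSys.{u}} {x x' : X} (h : X.Asymptotic x x') : C(X, ℤ) →+ ℤ where
  toFun f := ∑ᶠ n : ℤ, (f ((X.map ^ n) x) - f ((X.map ^ n) x'))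
  map_zero' := by simp
  map_add' f g := by
    rw [← finsum_add_distrib (h.finite_support f) (h.finite_support g)]
    refine finsum_congr fun n => ?_
    simp only [ContinuousMap.add_apply]
    ring

lemma pairIndexFun_coboundary {X : DynSys.{u}} {x x' : X} (h : X.Asymptotic x x')
    (f : C(X, ℤ)) : pairIndexFun h (X.coboundary f) = 0 := by
  have hstep : ∀ (n : ℤ) (z : X), X.map ((X.map ^ n) z) = (X.map ^ (n + 1)) z := by
    intro n z
    rw [add_comm, zpow_one_add]
    rfl
  have hcomp : pairIndexFun h (f.comp X.shift) = pairIndexFun h f := by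
    change ∑ᶠ n : ℤ, (f (X.map ((X.map ^ n) x)) - f (X.map ((X.map ^ n) x'))) =
      ∑ᶠ n : ℤ, (f ((X.map ^ n) x) - f ((X.map ^ n) x'))
    simp only [hstep]
    exact finsum_comp_equiv (f := fun n : ℤ => f ((X.map ^ n) x) - f ((X.map ^ n) x'))
      (Equiv.addRight (1 : ℤ))
  change pairIndexFun h (f - f.comp X.shift) = 0
  rw [map_sub, hcomp, sub_self]

/-- The index homomorphism of an asymptotic pair on the group of coinvariants. -/
def pairIndex {X : DynSys.{u}} {x x' : X} (h : X.Asymptotic x x') : X.Coinv →+ ℤ :=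
  QuotientAddGroup.lift X.coboundary.range (pairIndexFun h) (by
    rintro _ ⟨f, rfl⟩
    exact pairIndexFun_coboundary h f)

/-- The setoid on `X` whose classes are the orbits. -/
def orbitSetoid (X : DynSys.{u}) : Setoid X where
  r x y := ∃ n : ℤ, (X.map ^ n) x = y
  iseqv :=
    { refl := fun x => ⟨0, by simp⟩
      symm := by
        rintro x y ⟨n, rfl⟩
        exact ⟨-n, by rw [← Homeomorph.mul_apply, ← zpow_add]; simp⟩
      trans := by
        rintro x y z ⟨n, rfl⟩ ⟨m, rfl⟩
        exact ⟨m + n, by rw [zpow_add, Homeomorph.mul_apply]⟩ }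

end DynSys

/-- A factor map: a continuous equivariant surjection. -/
structure FactorMap (X Y : DynSys.{u}) where
  toFun : C(X, Y)
  equivariant : ∀ x, toFun (X.map x) = Y.map (toFun x)
  surjective : Function.Surjective toFun

namespace FactorMap

variable {X Y : DynSys.{u}}

/-- The fibre over a point. -/
def fiber (π : FactorMap X Y) (y : Y) : Set X := π.toFun ⁻¹' {y}

/-- The set `B` of blown-up points: those with more than one preimage. -/
def blownUp (π : FactorMap X Y) : Set Y := {y | 1 < (π.fiber y).encard}

/-- 2-asymptotic (2-A) factor maps: every blown-up point has exactly two preimages, and they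
are asymptotic. -/
def IsTwoAsymptotic (π : FactorMap X Y) : Prop :=
  ∀ y ∈ π.blownUp, (π.fiber y).encard = 2 ∧
    ∀ x ∈ π.fiber y, ∀ x' ∈ π.fiber y, X.Asymptotic x x'

/-- The set of blown-up orbits. -/
abbrev BlownUpOrbits (π : FactorMap X Y) : Type u :=
  Quotient (Y.orbitSetoid.comap (Subtype.val : π.blownUp → Y))

namespace IsTwoAsymptotic

variable {π : FactorMap X Y}

lemma exists_pair (hπ : π.IsTwoAsymptotic) (o : π.BlownUpOrbits) :
    ∃ p : X × X, p.1 ≠ p.2 ∧ π.fiber (Quotient.out o).1 = {p.1, p.2} := by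
  obtain ⟨x, x', hne, h⟩ := Set.encard_eq_two.1 (hπ _ (Quotient.out o).2).1
  exact ⟨(x, x'), hne, h⟩

/-- A choice, for every blown-up orbit, of a representative `y` and of an order `(x, x')` on the
two points of the fibre over `y`. -/
def pair (hπ : π.IsTwoAsymptotic) (o : π.BlownUpOrbits) : X × X := (hπ.exists_pair o).choose

lemma pair_asymptotic (hπ : π.IsTwoAsymptotic) (o : π.BlownUpOrbits) :
    X.Asymptotic (hπ.pair o).1 (hπ.pair o).2 := by
  have h := (hπ.exists_pair o).choose_spec.2
  refine (hπ _ (Quotient.out o).2).2 _ ?_ _ ?_ <;> rw [h] <;> simp [pair]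

/-- The index homomorphism of a 2-A factor map: its components are the index homomorphisms of
the chosen asymptotic pairs, one for every blown-up orbit. The values are recorded in the full
product of copies of `ℤ`. When only finitely many components are nonzero at each class, this is
the usual index homomorphism into the direct sum, and the images of the group and of its
subgroups are the same. Another choice of the pairs changes only the signs of components. -/
def index (hπ : π.IsTwoAsymptotic) : X.Coinv →+ (π.BlownUpOrbits → ℤ) :=
  AddMonoidHom.pi fun o => DynSys.pairIndex (hπ.pair_asymptotic o)

/-- The quotient `Index(Coinv) / Index(Inf)` is a torsion group. -/
def IsInfinitesimal (hπ : π.IsTwoAsymptotic) : Prop :=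
  IsAddTorsion
    (hπ.index.range ⧸ (X.infinitesimals.map hπ.index).addSubgroupOf hπ.index.range)

end IsTwoAsymptotic

/-- 2-AI factor maps: infinitesimal 2-asymptotic factor maps. -/
def IsTwoAI (π : FactorMap X Y) : Prop := ∃ hπ : π.IsTwoAsymptotic, hπ.IsInfinitesimal

end FactorMap

namespace DynSys

/-- Elementary 2-AI equivalence of zero-dimensional systems: both are 2-AI factors of one
zero-dimensional system. -/
def ElemTwoAIEquiv (Y₁ Y₂ : DynSys.{u}) : Prop :=
  Y₁.IsZeroDim ∧ Y₂.IsZeroDim ∧ ∃ X : DynSys.{u}, X.IsZeroDim ∧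
    (∃ π : FactorMap X Y₁, π.IsTwoAI) ∧ (∃ π : FactorMap X Y₂, π.IsTwoAI)

/-- 2-AI equivalence of zero-dimensional systems: the transitive closure of elementary
2-AI equivalence. -/
def TwoAIEquiv : DynSys.{u} → DynSys.{u} → Prop := Relation.TransGen ElemTwoAIEquiv

end DynSys

end

/-! The engine is the identity: the kernel of the index homomorphism of a 2-A factor map is the
image of the coinvariants of the factor (`exists_pullback_eq`, `index_pullback`). Being
infinitesimal then means that each class of the extension has a positive multiple which, modulo an
infinitesimal, is pulled back from the factor (`exists_nsmul_eq`). States ignore infinitesimals, so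
for a 2-AI map a state has the same rational image as its restriction to the factor, which is claim
1. For claim 2, equality of the rational images gives, for each class `c`, some `m > 0` and `d` with
`m τX(c) = τY(d)`; then `m c - π^* d` is infinitesimal by unique ergodicity, and has the index of `m
c`.

For claim 3 the intermediate systems are only zero-dimensional. Every state of a factor lifts to the
extension (`exists_state_lift`), and for 2-AI maps the lift is unique (`state_ext`). Hence having
exactly one state, with a given rational image, passes along each elementary equivalence.

For the kernel, let `f` have index zero and put `F(x,x') = f(x) - f(x')` on the fibre product of `X`
with itself over `Y`. Asymptoticity makes every orbit off the diagonal leave each compact set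
avoiding the diagonal. Such a system has no cohomological obstruction except the sums along orbits
(`isCoboundaryOn_of_finsum_eq_zero`), so `F = H - H ∘ s` with `H` zero on the diagonal. This `H` is
antisymmetric, hence of the form `h(x) - h(x')`, and `f - (h - h ∘ S)` is constant on fibres: it
descends to `Y`. -/

noncomputable section

open scoped CompactlySupported

/-! ### Positive functionals on spaces of continuous functions -/

/-- The restriction of an integer valued continuous function to a clopen set, extended by zero. -/
def clopenRestrict {X : Type*} [TopologicalSpace X] {U : Set X} (hU : IsClopen U) (f : C(X, ℤ)) :
    C(X, ℤ) :=
  ⟨U.indicator f, f.continuous.indicator (by simp [hU.frontier_eq])⟩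

lemma clopenRestrict_apply {X : Type*} [TopologicalSpace X] {U : Set X} (hU : IsClopen U)
    (f : C(X, ℤ)) (x : X) : clopenRestrict hU f x = U.indicator f x := rfl

/-- An integer valued continuous function, seen as real valued. -/
def intToReal {X : Type*} [TopologicalSpace X] (f : C(X, ℤ)) : C(X, ℝ) :=
  ⟨fun x => (f x : ℝ), by fun_prop⟩

lemma intToReal_apply {X : Type*} [TopologicalSpace X] (f : C(X, ℤ)) (x : X) :
    intToReal f x = (f x : ℝ) := rfl

/-- Pointwise bounded families of linear functionals converge along ultrafilters. -/
lemma exists_ultrafilter_limit {ι A : Type*} [AddCommGroup A] [Module ℝ A] (U : Ultrafilter ι)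
    (φ : ι → A →ₗ[ℝ] ℝ) (hφ : ∀ a, ∃ C, ∀ i, |φ i a| ≤ C) :
    ∃ ψ : A →ₗ[ℝ] ℝ, ∀ a, Tendsto (fun i => φ i a) U (𝓝 (ψ a)) := by
  have hlim : ∀ a, ∃ l, Tendsto (fun i => φ i a) U (𝓝 l) := by
    intro a
    obtain ⟨C, hC⟩ := hφ a
    obtain ⟨l, -, hl⟩ := (isCompact_Icc (a := -C) (b := C)).ultrafilter_le_nhds
      (U.map fun i => φ i a) (by
        rw [Ultrafilter.coe_map, le_principal_iff]
        exact mem_map.2 (Eventually.of_forall fun i => abs_le.1 (hC i)))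
    exact ⟨l, hl⟩
  choose l hl using hlim
  refine ⟨{ toFun := l, map_add' := fun a b => ?_, map_smul' := fun c a => ?_ }, hl⟩
  · refine tendsto_nhds_unique (hl (a + b)) ?_
    simpa using (hl a).add (hl b)
  · refine tendsto_nhds_unique (hl (c • a)) ?_
    simpa using (hl a).const_mul c

/-- A positive functional on the integer valued functions of a zero-dimensional space `Y` lifts to
a positive linear functional on the real valued functions of any extension `X` of `Y`. -/
lemma exists_positive_lift {X Y : Type*} [TopologicalSpace X] [CompactSpace X]
    [TopologicalSpace Y] [CompactSpace Y] (π : C(X, Y)) (hπ : Function.Surjective π)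
    (σ : C(Y, ℤ) →+ ℝ) (hσ : ∀ f : C(Y, ℤ), (∀ y, 0 ≤ f y) → 0 ≤ σ f) :
    ∃ Λ : C(X, ℝ) →ₗ[ℝ] ℝ, (∀ f, (∀ x, 0 ≤ f x) → 0 ≤ Λ f) ∧
      ∀ g : C(Y, ℤ), Λ (intToReal (g.comp π)) = σ g := by
  classical
  let ind (q : DiscreteQuotient Y) (v : q) : C(Y, ℤ) := clopenRestrict (q.isClopen_preimage {v}) 1
  have hind : ∀ q v y, ind q v y = if q.proj y = v then 1 else 0 := by
    intro q v y
    simp [ind, clopenRestrict_apply, Set.indicator_apply]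
  -- Each cell of a finite clopen partition `q` of `Y` gets a sample point in `X`. The Riemann sums
  -- weighted by `σ` of the cells then make sense for every continuous function on `X`.
  have hsurj : ∀ (q : DiscreteQuotient Y) (v : q), ∃ x : X, q.proj (π x) = v := fun q v => by
    obtain ⟨y, hy⟩ := q.proj_surjective v
    obtain ⟨x, rfl⟩ := hπ y
    exact ⟨x, hy⟩
  choose s hs using hsurj
  have hpos : ∀ q v, 0 ≤ σ (ind q v) := fun q v => hσ _ fun y => by
    rw [hind]; split_ifs <;> simp
  have : ∀ q : DiscreteQuotient Y, Fintype q := fun q => Fintype.ofFinite q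
  have hsum : ∀ (q : DiscreteQuotient Y) (g : C(Y, ℤ)) (c : q → ℤ),
      (∀ y, g y = c (q.proj y)) → ∑ v, σ (ind q v) * (c v : ℝ) = σ g := by
    intro q g c hc
    have : g = ∑ v, c v • ind q v := by
      ext y
      simp [ContinuousMap.coe_sum, hind, hc]
    rw [this, map_sum]
    refine Finset.sum_congr rfl fun v _ => ?_
    rw [map_zsmul, zsmul_eq_mul, mul_comm]
  let φ (q : DiscreteQuotient Y) : C(X, ℝ) →ₗ[ℝ] ℝ :=
    { toFun := fun f => ∑ v, σ (ind q v) * f (s q v)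
      map_add' := fun f g => by simp [mul_add, Finset.sum_add_distrib]
      map_smul' := fun c f => by
        simp only [ContinuousMap.smul_apply, smul_eq_mul, RingHom.id_apply, Finset.mul_sum]
        exact Finset.sum_congr rfl fun v _ => by ring }
  have hφ : ∀ q f, φ q f = ∑ v, σ (ind q v) * f (s q v) := fun _ _ => rfl
  obtain ⟨Λ, hΛ⟩ := exists_ultrafilter_limit (Ultrafilter.of (atBot : Filter (DiscreteQuotient Y)))
    φ (fun f => ⟨σ 1 * ‖f‖, fun q => by
      have h1 : ∑ v, σ (ind q v) = σ 1 := by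
        have := hsum q 1 (fun _ => 1) (fun y => by simp)
        simpa using this
      rw [hφ, ← h1, Finset.sum_mul]
      refine (Finset.abs_sum_le_sum_abs _ _).trans (Finset.sum_le_sum fun v _ => ?_)
      rw [abs_mul, abs_of_nonneg (hpos q v)]
      exact mul_le_mul_of_nonneg_left (f.norm_coe_le_norm _) (hpos q v)⟩)
  refine ⟨Λ, fun f hf => ge_of_tendsto' (hΛ f) fun q => ?_, fun g => ?_⟩
  · exact Finset.sum_nonneg fun v _ => mul_nonneg (hpos q v) (hf _)
  · refine tendsto_nhds_unique (hΛ _) (tendsto_const_nhds.congr' ?_)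
    let lc : LocallyConstant Y ℤ := ⟨g, (IsLocallyConstant.iff_continuous _).2 g.continuous⟩
    -- Once `q` refines the partition into level sets of `g`, the Riemann sum of `g ∘ π` equals `σ
    -- g` exactly.
    refine Ultrafilter.of_le _ ((eventually_le_atBot lc.discreteQuotient).mono fun q hq => ?_)
    change σ g = φ q _
    rw [hφ]
    refine (hsum q g (fun v => g (π (s q v))) fun y => ?_).symm
    have h1 := DiscreteQuotient.ofLE_proj hq y
    have h2 := DiscreteQuotient.ofLE_proj hq (π (s q (q.proj y)))
    rw [hs] at h2
    have h3 := congrFun lc.lift_comp_proj y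
    have h4 := congrFun lc.lift_comp_proj (π (s q (q.proj y)))
    simp only [Function.comp_apply, ← h1, ← h2] at h3 h4
    exact h3.symm.trans h4

/-! ### States and factor maps -/

namespace DynSys

lemma IsZeroDim.totallySeparatedSpace {X : DynSys.{u}} (h : X.IsZeroDim) :
    TotallySeparatedSpace X :=
  totallySeparatedSpace_of_t0_of_basis_clopen h

lemma IsCantor.isZeroDim {X : DynSys.{u}} (h : X.IsCantor) : X.IsZeroDim := by
  obtain ⟨e⟩ := h
  have : TotallyDisconnectedSpace X := e.symm.totallyDisconnectedSpace
  exact isTopologicalBasis_isClopen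

lemma isState_comp {X Y : DynSys.{u}} {τ : X.Coinv →+ ℝ} (hτ : X.IsState τ)
    (φ : Y.Coinv →+ X.Coinv) (π : C(X, Y)) (hφ : ∀ g, φ (Y.cls g) = X.cls (g.comp π)) :
    Y.IsState (τ.comp φ) where
  nonneg f hf := by
    rw [AddMonoidHom.comp_apply, hφ]
    exact hτ.nonneg _ fun x => hf _
  one := by
    rw [AddMonoidHom.comp_apply, hφ]
    exact hτ.one

lemma cls_comp_shift (X : DynSys.{u}) (f : C(X, ℤ)) : X.cls (f.comp X.shift) = X.cls f := by
  refine (QuotientAddGroup.eq.2 ⟨f, ?_⟩)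
  rw [neg_add_eq_sub]
  rfl

end DynSys

namespace FactorMap

variable {X Y : DynSys.{u}}

/-- The homomorphism of the groups of coinvariants induced by a factor map. -/
def pullback (π : FactorMap X Y) : Y.Coinv →+ X.Coinv :=
  QuotientAddGroup.map _ _ (ContinuousMap.compAddMonoidHom' π.toFun) (by
    rintro _ ⟨f, rfl⟩
    refine ⟨f.comp π.toFun, ?_⟩
    ext x
    exact congrArg (fun y => f (π.toFun x) - f y) (π.equivariant x))

lemma pullback_cls (π : FactorMap X Y) (g : C(Y, ℤ)) :
    π.pullback (Y.cls g) = X.cls (g.comp π.toFun) := rfl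

lemma isState_comp_pullback (π : FactorMap X Y) {τ : X.Coinv →+ ℝ} (hτ : X.IsState τ) :
    Y.IsState (τ.comp π.pullback) :=
  DynSys.isState_comp hτ _ π.toFun π.pullback_cls

/-- Every state of a factor lifts to a state of the extension. -/
lemma exists_state_lift (π : FactorMap X Y) {σ : Y.Coinv →+ ℝ} (hσ : Y.IsState σ) :
    ∃ τ : X.Coinv →+ ℝ, X.IsState τ ∧ τ.comp π.pullback = σ := by
  obtain ⟨Λ, hpos, hΛ⟩ := exists_positive_lift π.toFun π.surjective
    (σ.comp (QuotientAddGroup.mk' _)) hσ.nonneg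
  replace hΛ : ∀ g : C(Y, ℤ), Λ (intToReal (g.comp π.toFun)) = σ (Y.cls g) := hΛ
  let it (k : ℕ) : C(X, X) := ⟨X.map^[k], X.map.continuous.iterate k⟩
  have h1 : Λ 1 = 1 := by
    rw [← hσ.one, ← hΛ]
    congr 1
    ext x
    simp [intToReal_apply]
  have hbd : ∀ f : C(X, ℝ), |Λ f| ≤ ‖f‖ := by
    intro f
    have e1 := hpos (‖f‖ • 1 - f) fun x => by
      have := (abs_le.1 (f.norm_coe_le_norm x)).2
      simpa using this
    have e2 := hpos (‖f‖ • 1 + f) fun x => by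
      have := (abs_le.1 (f.norm_coe_le_norm x)).1
      simp
      linarith
    rw [map_sub, map_smul, h1] at e1
    rw [map_add, map_smul, h1] at e2
    simp at e1 e2
    exact abs_le.2 ⟨by linarith, by linarith⟩
  -- `Λ` extends `σ` but need not be invariant; Cesàro averages, as in the Krylov–Bogolyubov
  -- argument, repair this in the limit.
  let φ (n : ℕ) : C(X, ℝ) →ₗ[ℝ] ℝ :=
    { toFun := fun f => (n + 1 : ℝ)⁻¹ * ∑ k ∈ Finset.range (n + 1), Λ (f.comp (it k))
      map_add' := fun f g => by
        simp only [ContinuousMap.add_comp, map_add, Finset.sum_add_distrib, mul_add]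
      map_smul' := fun c f => by
        simp only [ContinuousMap.smul_comp, map_smul, smul_eq_mul, RingHom.id_apply,
          ← Finset.mul_sum]
        ring }
  have hφ : ∀ n f, φ n f = (n + 1 : ℝ)⁻¹ * ∑ k ∈ Finset.range (n + 1), Λ (f.comp (it k)) :=
    fun _ _ => rfl
  have hnorm : ∀ (f : C(X, ℝ)) k, ‖f.comp (it k)‖ ≤ ‖f‖ := fun f k =>
    (ContinuousMap.norm_le _ (norm_nonneg _)).2 fun x => f.norm_coe_le_norm _
  obtain ⟨Ψ, hΨ⟩ := exists_ultrafilter_limit (Ultrafilter.of (atTop : Filter ℕ)) φ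
    (fun f => ⟨‖f‖, fun n => by
      rw [hφ, abs_mul, abs_of_pos (by positivity), inv_mul_le_iff₀ (by positivity)]
      refine (Finset.abs_sum_le_sum_abs _ _).trans
        ((Finset.sum_le_sum fun k _ => (hbd _).trans (hnorm f k)).trans ?_)
      simp⟩)
  have hinv : ∀ f : C(X, ℝ), Ψ (f - f.comp X.shift) = 0 := by
    intro f
    refine tendsto_nhds_unique (hΨ _) ?_
    have key : ∀ n, φ n (f - f.comp X.shift) =
        (n + 1 : ℝ)⁻¹ * (Λ f - Λ (f.comp (it (n + 1)))) := by
      intro n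
      rw [hφ]
      congr 1
      have hstep : ∀ k, Λ ((f - f.comp X.shift).comp (it k)) =
          Λ (f.comp (it k)) - Λ (f.comp (it (k + 1))) := by
        intro k
        rw [← map_sub]
        congr 1
        ext x
        simp only [ContinuousMap.comp_apply, ContinuousMap.sub_apply, it, ContinuousMap.coe_mk,
          Function.iterate_succ_apply', DynSys.shift]
      simp only [hstep]
      rw [Finset.sum_range_sub']
      rfl
    simp only [key]
    have hz : Tendsto (fun n : ℕ => (n + 1 : ℝ)⁻¹ * (2 * ‖f‖)) atTop (𝓝 0) := by
      have := (tendsto_one_div_add_atTop_nhds_zero_nat (𝕜 := ℝ)).mul_const (2 * ‖f‖)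
      simpa using this
    refine (squeeze_zero_norm (fun n => ?_) hz).mono_left (Ultrafilter.of_le _)
    rw [norm_mul, Real.norm_of_nonneg (by positivity : (0 : ℝ) ≤ (n + 1 : ℝ)⁻¹)]
    refine mul_le_mul_of_nonneg_left ?_ (by positivity)
    refine (abs_sub _ _).trans ?_
    have e1 := hbd f
    have e2 := (hbd _).trans (hnorm f (n + 1))
    linarith
  have hpi : ∀ g : C(Y, ℤ), Ψ (intToReal (g.comp π.toFun)) = σ (Y.cls g) := by
    intro g
    refine tendsto_nhds_unique (hΨ _) (tendsto_const_nhds.congr fun n => ?_)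
    -- On functions from `Y` the averaging changes nothing, since `σ` is already defined on
    -- coinvariants.
    have hk : ∀ k, Λ ((intToReal (g.comp π.toFun)).comp (it k)) = σ (Y.cls g) := by
      intro k
      induction k generalizing g with
      | zero => rw [← hΛ]; rfl
      | succ k ih =>
        rw [← DynSys.cls_comp_shift, ← ih]
        congr 1
        ext x
        simp only [ContinuousMap.comp_apply, intToReal_apply, it, ContinuousMap.coe_mk,
          Function.iterate_succ_apply', DynSys.shift, π.equivariant]
    rw [hφ]
    simp only [hk, Finset.sum_const, Finset.card_range, nsmul_eq_mul]
    push_cast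
    rw [← mul_assoc, inv_mul_cancel₀ (by positivity), one_mul]
  have hΨpos : ∀ f : C(X, ℝ), (∀ x, 0 ≤ f x) → 0 ≤ Ψ f := fun f hf =>
    ge_of_tendsto' (hΨ f) fun n => mul_nonneg (by positivity)
      (Finset.sum_nonneg fun k _ => hpos _ fun x => hf _)
  let t : C(X, ℤ) →+ ℝ :=
    { toFun := fun f => Ψ (intToReal f)
      map_zero' := by
        rw [← map_zero Ψ]
        congr 1
        ext x
        simp [intToReal_apply]
      map_add' := fun f g => by
        rw [← map_add]
        congr 1
        ext x
        simp [intToReal_apply] }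
  refine ⟨QuotientAddGroup.lift _ t ?_, ⟨fun f hf => ?_, ?_⟩, ?_⟩
  · rintro _ ⟨f, rfl⟩
    rw [AddMonoidHom.mem_ker, ← hinv (intToReal f)]
    change Ψ _ = _
    congr 1
    ext x
    simp [intToReal_apply, DynSys.coboundary]
  · exact hΨpos _ fun x => by simpa [intToReal_apply] using hf x
  · rw [← hσ.one, ← hpi]
    rfl
  · ext g
    exact hpi g

end FactorMap

/-! ### States as invariant measures -/

/-- A positive linear functional on the continuous functions of a compact space, normalized at `1`,
is the integral against a probability measure. -/
lemma exists_measure_of_positive {X : Type*} [TopologicalSpace X] [T2Space X] [CompactSpace X]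
    [MeasurableSpace X] [BorelSpace X] (Λ : C(X, ℝ) →ₗ[ℝ] ℝ)
    (hΛ : ∀ f : C(X, ℝ), (∀ x, 0 ≤ f x) → 0 ≤ Λ f) (h1 : Λ 1 = 1) :
    ∃ μ : Measure X, IsProbabilityMeasure μ ∧ ∀ f : C(X, ℝ), ∫ x, f x ∂μ = Λ f := by
  let L : C_c(X, ℝ) →ₚ[ℝ] ℝ :=
    { toFun := fun f => Λ f.toContinuousMap
      map_add' := fun f g => map_add Λ f.toContinuousMap g.toContinuousMap
      map_smul' := fun c f => map_smul Λ c f.toContinuousMap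
      monotone' := fun f g hfg => by
        have := hΛ (g.toContinuousMap - f.toContinuousMap) fun x => sub_nonneg.2 (hfg x)
        rwa [map_sub, sub_nonneg] at this }
  have hint : ∀ f : C(X, ℝ), ∫ x, f x ∂(RealRMK.rieszMeasure L) = Λ f := fun f =>
    RealRMK.integral_rieszMeasure L (CompactlySupportedContinuousMap.continuousMapEquiv f)
  refine ⟨RealRMK.rieszMeasure L, ⟨?_⟩, hint⟩
  have := hint 1
  rw [h1] at this
  simp only [ContinuousMap.one_apply, integral_const, smul_eq_mul, mul_one] at this
  rw [Measure.real, ENNReal.toReal_eq_one_iff] at this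
  exact this

namespace DynSys

/-- States of zero-dimensional systems are given by invariant probability measures. -/
lemma IsState.exists_measure {X : DynSys.{u}} (hX : X.IsZeroDim) {τ : X.Coinv →+ ℝ}
    (hτ : X.IsState τ) :
    ∃ μ : Measure X, (IsProbabilityMeasure μ ∧ μ.map X.map = μ) ∧
      ∀ f : C(X, ℤ), ∫ x, (f x : ℝ) ∂μ = τ (X.cls f) := by
  obtain ⟨Λ, hpos, hΛ⟩ := exists_positive_lift (ContinuousMap.id X) Function.surjective_id
    (τ.comp (QuotientAddGroup.mk' _)) hτ.nonneg
  replace hΛ : ∀ f : C(X, ℤ), Λ (intToReal f) = τ (X.cls f) := hΛ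
  have h1 : Λ 1 = 1 := by
    rw [← hτ.one, ← hΛ]
    congr 1
    ext x
    simp [intToReal_apply]
  obtain ⟨μ, hμ, hint⟩ := exists_measure_of_positive Λ hpos h1
  have hintZ : ∀ f : C(X, ℤ), ∫ x, (f x : ℝ) ∂μ = τ (X.cls f) := fun f =>
    (hint (intToReal f)).trans (hΛ f)
  refine ⟨μ, ⟨hμ, ?_⟩, hintZ⟩
  have hmeas : Measurable X.map := X.map.continuous.measurable
  have hclopen : ∀ {U : Set X} (hU : IsClopen U), μ.real U = τ (X.cls (clopenRestrict hU 1)) := by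
    intro U hU
    rw [← hintZ, ← integral_indicator_one hU.isOpen.measurableSet]
    congr 1
    ext x
    by_cases hx : x ∈ U <;> simp [clopenRestrict_apply, hx]
  have : IsProbabilityMeasure (μ.map X.map) := Measure.isProbabilityMeasure_map hmeas.aemeasurable
  -- Clopen sets form a π-system generating the Borel sets, and on them the measure is read off from
  -- `τ`, which does not see composition with the shift.
  refine ext_of_generate_finite {U : Set X | IsClopen U}
    (BorelSpace.measurable_eq.trans hX.borel_eq_generateFrom)
    (fun U hU V hV _ => hU.inter hV) (fun U hU => ?_) (by simp)
  rw [Measure.map_apply hmeas hU.isOpen.measurableSet, ← measureReal_eq_measureReal_iff,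
    hclopen (hU.preimage X.map.continuous), hclopen hU,
    ← cls_comp_shift X (clopenRestrict hU 1)]
  rfl

/-- A uniquely ergodic zero-dimensional system has at most one state. -/
lemma IsUniquelyErgodic.state_unique {X : DynSys.{u}} (hX : X.IsZeroDim)
    (he : X.IsUniquelyErgodic) {τ τ' : X.Coinv →+ ℝ} (hτ : X.IsState τ) (hτ' : X.IsState τ') :
    τ = τ' := by
  obtain ⟨μ, hμ, hint⟩ := hτ.exists_measure hX
  obtain ⟨μ', hμ', hint'⟩ := hτ'.exists_measure hX
  obtain rfl := he.unique hμ hμ'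
  ext f
  exact (hint f).symm.trans (hint' f)

end DynSys

/-! ### Cohomology of dissipative systems -/

section Cohomology

variable {R : Type*} [TopologicalSpace R]

/-- `F` is the coboundary of an integer valued continuous function vanishing off `W`. -/
def IsCoboundaryOn (s : R ≃ₜ R) (W : Set R) (F : C(R, ℤ)) : Prop :=
  ∃ H : C(R, ℤ), (∀ p ∉ W, H p = 0) ∧ ∀ p, F p = H p - H (s p)

namespace IsCoboundaryOn

variable {s : R ≃ₜ R} {W W' : Set R} {F G : C(R, ℤ)}

lemma zero : IsCoboundaryOn s W 0 := ⟨0, by simp, by simp⟩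

lemma mono (hF : IsCoboundaryOn s W F) (h : W ⊆ W') : IsCoboundaryOn s W' F := by
  obtain ⟨H, h0, hH⟩ := hF
  exact ⟨H, fun p hp => h0 p fun h' => hp (h h'), hH⟩

lemma add (hF : IsCoboundaryOn s W F) (hG : IsCoboundaryOn s W G) :
    IsCoboundaryOn s W (F + G) := by
  obtain ⟨H, h0, hH⟩ := hF
  obtain ⟨H', h0', hH'⟩ := hG
  refine ⟨H + H', fun p hp => by simp [h0 p hp, h0' p hp], fun p => ?_⟩
  simp only [ContinuousMap.add_apply, hH, hH']
  ring

lemma neg (hF : IsCoboundaryOn s W F) : IsCoboundaryOn s W (-F) := by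
  obtain ⟨H, h0, hH⟩ := hF
  refine ⟨-H, fun p hp => by simp [h0 p hp], fun p => ?_⟩
  simp only [ContinuousMap.neg_apply, hH]
  ring

lemma sum {ι : Type*} (t : Finset ι) {F : ι → C(R, ℤ)} (h : ∀ i ∈ t, IsCoboundaryOn s W (F i)) :
    IsCoboundaryOn s W (∑ i ∈ t, F i) :=
  Finset.sum_induction F (IsCoboundaryOn s W) (fun _ _ => add) zero h

end IsCoboundaryOn

lemma zpow_succ_apply (s : R ≃ₜ R) (n : ℤ) (p : R) : (s ^ (n + 1)) p = s ((s ^ n) p) := by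
  rw [add_comm, zpow_one_add]
  rfl

lemma zpow_succ_apply' (s : R ≃ₜ R) (n : ℤ) (p : R) : (s ^ (n + 1)) p = (s ^ n) (s p) := by
  rw [zpow_add_one]
  rfl

lemma zpow_add_apply (s : R ≃ₜ R) (m n : ℤ) (p : R) : (s ^ (m + n)) p = (s ^ m) ((s ^ n) p) := by
  rw [zpow_add]
  rfl

lemma zpow_mem_iff {s : R ≃ₜ R} {W : Set R} (hW : ∀ p, s p ∈ W ↔ p ∈ W) (n : ℤ) (p : R) :
    (s ^ n) p ∈ W ↔ p ∈ W := by
  induction n with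
  | zero => simp
  | succ n ih => rw [zpow_succ_apply, hW, ih]
  | pred n ih => rw [← ih, ← hW, ← zpow_succ_apply, sub_add_cancel]

/-- Composition with a power of the homeomorphism does not change the class modulo coboundaries. -/
lemma isCoboundaryOn_sub_zpow {s : R ≃ₜ R} {W : Set R} (hW : ∀ p, s p ∈ W ↔ p ∈ W)
    {F : C(R, ℤ)} (hF : ∀ p ∉ W, F p = 0) (n : ℤ) :
    IsCoboundaryOn s W (F - F.comp ((s ^ n : R ≃ₜ R) : C(R, R))) := by
  have hstep : ∀ n : ℤ, IsCoboundaryOn s W (F.comp ((s ^ n : R ≃ₜ R) : C(R, R)) -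
      F.comp ((s ^ (n + 1) : R ≃ₜ R) : C(R, R))) := fun n =>
    ⟨F.comp ((s ^ n : R ≃ₜ R) : C(R, R)), fun p hp => hF _ (by simpa [zpow_mem_iff hW] using hp),
      fun p => congrArg (fun q => F ((s ^ n) p) - F q) (zpow_succ_apply' s n p)⟩
  induction n with
  | zero =>
    convert IsCoboundaryOn.zero
    ext p
    simp
  | succ n ih => simpa using ih.add (hstep n)
  | pred n ih =>
    have := ih.add (hstep (-n - 1)).neg
    rw [sub_add_cancel] at this
    simpa using this

/-- The sum telescopes: `H` has finitely many nonzero values along the orbit, so its sum equals that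
of its shift. -/
lemma IsCoboundaryOn.finsum_eq_zero {s : R ≃ₜ R} {W : Set R} {F : C(R, ℤ)}
    (hfin : ∀ H : C(R, ℤ), (∀ p ∉ W, H p = 0) →
      ∀ p, (Function.support fun n : ℤ => H ((s ^ n) p)).Finite)
    (hF : IsCoboundaryOn s W F) (p : R) : ∑ᶠ n : ℤ, F ((s ^ n) p) = 0 := by
  obtain ⟨H, h0, hH⟩ := hF
  have hf := hfin H h0 p
  have he := finsum_comp_equiv (f := fun n : ℤ => H ((s ^ n) p)) (Equiv.addRight (1 : ℤ))
  have hf' : (Function.support fun n : ℤ => H ((s ^ (n + 1)) p)).Finite :=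
    hf.preimage (f := fun n : ℤ => n + 1) (add_left_injective 1).injOn
  simp only [hH, ← zpow_succ_apply]
  rw [finsum_sub_distrib hf hf', sub_eq_zero]
  exact he.symm

variable [CompactSpace R] [T2Space R] [TotallyDisconnectedSpace R]

/-- In a zero-dimensional system with a closed set `D` off which every orbit is dissipative, an open
set `W` that does not contain the complement of `D` admits a clopen set, disjoint from `D` and not
contained in `W`, whose points off `W` never return to it. -/
lemma exists_wandering_clopen (s : R ≃ₜ R) {D : Set R} (hDc : IsClosed D)
    (hfin : ∀ H : C(R, ℤ), (∀ p ∈ D, H p = 0) →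
      ∀ p, (Function.support fun n : ℤ => H ((s ^ n) p)).Finite)
    {W : Set R} (hWo : IsOpen W) {z : R} (hzW : z ∉ W) (hzD : z ∉ D) :
    ∃ U : Set R, IsClopen U ∧ Disjoint U D ∧ (∃ p ∈ U, p ∉ W) ∧
      ∀ p ∈ U, p ∉ W → ∀ n : ℤ, (s ^ n) p ∈ U → n = 0 := by
  obtain ⟨K, hK, hzK, hKD⟩ := compact_exists_isClopen_in_isOpen hDc.isOpen_compl hzD
  have hvis : ∀ p, {n : ℤ | (s ^ n) p ∈ K}.Finite := by
    intro p
    refine (hfin (clopenRestrict hK 1) (fun q hq => ?_) p).subset fun n hn => ?_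
    · have : q ∉ K := fun h => hKD h hq
      simp [clopenRestrict_apply, this]
    · have : (s ^ n) p ∈ K := hn
      simp [clopenRestrict_apply, this]
  let C : Set R := K ∩ Wᶜ
  have hC : IsClosed C := hK.isClosed.inter hWo.isClosed_compl
  have : CompactSpace C := isCompact_iff_compactSpace.1 hC.isCompact
  have : Nonempty C := ⟨⟨z, hzK, hzW⟩⟩
  -- Every orbit visits `K` finitely often, but without a given uniform bound on the times. Baire's
  -- theorem on the compact set `C` supplies a bound `N` near some point `p₀`.
  let A (N : ℕ) : Set C := {p | ∀ n : ℤ, (N : ℤ) < |n| → (s ^ n) (p : R) ∉ K}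
  have hAc : ∀ N, IsClosed (A N) := by
    intro N
    simp only [A, Set.ofPred_forall]
    exact isClosed_iInter fun n => isClosed_iInter fun _ =>
      hK.compl.isClosed.preimage ((s ^ n).continuous.comp continuous_subtype_val)
  have hAu : ⋃ N, A N = Set.univ := by
    refine Set.eq_univ_of_forall fun p => Set.mem_iUnion.2 ?_
    obtain ⟨b, hb⟩ := ((hvis p).image fun n => |n|).bddAbove
    refine ⟨b.toNat, fun n hn hnK => ?_⟩
    have := hb ⟨n, hnK, rfl⟩
    have := Int.self_le_toNat b
    simp only at *
    omega
  obtain ⟨N, p₀, hp₀⟩ := nonempty_interior_of_iUnion_of_closed hAc hAu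
  obtain ⟨O', hO'A, hO'o, hp₀O'⟩ := mem_interior.1 hp₀
  obtain ⟨O, hO, rfl⟩ := isOpen_induced_iff.1 hO'o
  have haper : ∀ n : ℤ, n ≠ 0 → (s ^ n) (p₀ : R) ≠ p₀ := by
    intro n hn h
    have hmul : ∀ k : ℤ, (s ^ (n * k)) (p₀ : R) = p₀ := by
      intro k
      rw [zpow_mul]
      induction k with
      | zero => simp
      | succ k ih => rw [zpow_succ_apply, ih, h]
      | pred k ih =>
        have h2 := zpow_succ_apply (s ^ n) (-k - 1) (p₀ : R)
        rw [sub_add_cancel, ih] at h2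
        exact (s ^ n).injective (h2.symm.trans h.symm)
    refine Set.infinite_univ (α := ℤ) (((hvis p₀).preimage
      (f := fun k => n * k) (mul_right_injective₀ hn).injOn).subset fun k _ => ?_)
    change (s ^ (n * k)) (p₀ : R) ∈ K
    rw [hmul]
    exact p₀.2.1
  have hsep : ∀ n : ℤ, ∃ V : Set R, IsOpen V ∧ (p₀ : R) ∈ V ∧
      (n ≠ 0 → ∀ p ∈ V, (s ^ n) p ∉ V) := by
    intro n
    rcases eq_or_ne n 0 with rfl | hn
    · exact ⟨Set.univ, isOpen_univ, trivial, fun h => absurd rfl h⟩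
    obtain ⟨a, b, ha, hb, hpa, hpb, hab⟩ := t2_separation (haper n hn).symm
    exact ⟨a ∩ (s ^ n) ⁻¹' b, ha.inter (hb.preimage (s ^ n).continuous), ⟨hpa, hpb⟩,
      fun _ p hp hp' => Set.disjoint_left.1 hab hp'.1 hp.2⟩
  choose V hVo hpV hV using hsep
  -- Returns at times beyond `N` are excluded by `O`, and those at nonzero times up to `N` by the
  -- sets `V n`, which separate `p₀` from its translates.
  obtain ⟨U, hU, hpU, hUsub⟩ := compact_exists_isClopen_in_isOpen
    ((hO.inter hK.isOpen).inter
      (isOpen_biInter_finset (s := Finset.Icc (-(N : ℤ)) N) fun n _ => hVo n))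
    (show (p₀ : R) ∈ _ from ⟨⟨hp₀O', p₀.2.1⟩, Set.mem_iInter₂.2 fun n _ => hpV n⟩)
  refine ⟨U, hU, Set.disjoint_left.2 fun p hp => hKD (hUsub hp).1.2, ⟨p₀, hpU, p₀.2.2⟩,
    fun p hp hpW n hn => by_contra fun hn0 => ?_⟩
  rcases lt_or_ge (N : ℤ) |n| with hN | hN
  · exact hO'A (show (⟨p, (hUsub hp).1.2, hpW⟩ : C) ∈ _ from (hUsub hp).1.1) n hN (hUsub hn).1.2
  · have hmem := Finset.mem_Icc.2 (abs_le.1 hN)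
    exact hV n hn0 p (Set.mem_iInter₂.1 (hUsub hp).2 n hmem)
      (Set.mem_iInter₂.1 (hUsub hn).2 n hmem)

/-- In a zero-dimensional system with a closed invariant set `D` off which every orbit is
dissipative, a function that vanishes on `D` and has vanishing sums along all orbits is the
coboundary of a function vanishing on `D`. -/
theorem isCoboundaryOn_of_finsum_eq_zero (s : R ≃ₜ R) {D : Set R} (hDc : IsClosed D)
    (hD : ∀ p, s p ∈ D ↔ p ∈ D)
    (hfin : ∀ H : C(R, ℤ), (∀ p ∈ D, H p = 0) →
      ∀ p, (Function.support fun n : ℤ => H ((s ^ n) p)).Finite)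
    (F : C(R, ℤ)) (hF : ∀ p ∈ D, F p = 0) (hsum : ∀ p, ∑ᶠ n : ℤ, F ((s ^ n) p) = 0) :
    IsCoboundaryOn s Dᶜ F := by
  classical
  let P (W : Set R) : Prop := ∀ F : C(R, ℤ), (∀ p ∉ W, F p = 0) →
    (∀ p, ∑ᶠ n : ℤ, F ((s ^ n) p) = 0) → IsCoboundaryOn s W F
  let S : Set (Set R) := {W | IsOpen W ∧ (∀ p, s p ∈ W ↔ p ∈ W) ∧ W ⊆ Dᶜ ∧ P W}
  have hcpt : ∀ F : C(R, ℤ), IsCompact {p | F p ≠ 0} := fun F =>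
    ((isClopen_discrete {0}ᶜ).preimage F.continuous).isClosed.isCompact
  -- Zorn's lemma on the open invariant sets over which the statement holds; a wandering clopen set
  -- enlarges any such set short of `Dᶜ`.
  obtain ⟨W, hW⟩ : ∃ W, Maximal (· ∈ S) W := by
    refine zorn_subset S fun c hcS hc => ⟨⋃₀ c, ⟨isOpen_sUnion fun W hW => (hcS hW).1,
      fun p => ?_, Set.sUnion_subset fun W hW => (hcS hW).2.2.1, fun F hF hsum => ?_⟩,
      fun W hW => Set.subset_sUnion_of_mem hW⟩
    · simp only [Set.mem_sUnion]
      exact exists_congr fun W => and_congr_right fun hW => (hcS hW).2.1 p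
    · rcases c.eq_empty_or_nonempty with rfl | hne
      · have : F = 0 := by
          ext p
          exact hF p (by simp)
        exact this ▸ IsCoboundaryOn.zero
      · have : Nonempty c := hne.to_subtype
        -- The support of `F` is compact, so a single member of the chain contains it.
        obtain ⟨W, hFW⟩ := (hcpt F).elim_directed_cover (fun W : c => (W : Set R))
          (fun W => (hcS W.2).1) (fun p hp => by
            rw [← Set.sUnion_eq_iUnion]
            exact by_contra fun h => hp (hF p h)) hc.directedOn.directed_val
        exact ((hcS W.2).2.2.2 F (fun p hp => by_contra fun h => hp (hFW h)) hsum).mono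
          (Set.subset_sUnion_of_mem W.2)
  obtain ⟨⟨hWo, hWs, hWD, hPW⟩, hmax⟩ := hW
  suffices hWD' : W = Dᶜ from
    hWD' ▸ hPW F (fun p hp => hF p (by simpa [hWD'] using hp)) hsum
  refine hWD.antisymm fun z hzD => by_contra fun hzW => ?_
  obtain ⟨U, hU, hUD, ⟨p₀, hp₀U, hp₀W⟩, hwan⟩ :=
    exists_wandering_clopen s hDc hfin hWo hzW hzD
  let T (n : ℤ) : Set R := (s ^ n) ⁻¹' U
  have hT : ∀ n, IsClopen (T n) := fun n => hU.preimage (s ^ n).continuous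
  let W' : Set R := W ∪ ⋃ n, T n
  have hW's : ∀ p, s p ∈ W' ↔ p ∈ W' := by
    intro p
    refine or_congr (hWs p) ?_
    simp only [Set.mem_iUnion, T, Set.mem_preimage, ← zpow_succ_apply']
    exact ⟨fun ⟨n, hn⟩ => ⟨n + 1, hn⟩, fun ⟨n, hn⟩ => ⟨n - 1, by rwa [sub_add_cancel]⟩⟩
  have hW'D : W' ⊆ Dᶜ := Set.union_subset hWD (Set.iUnion_subset fun n p hp hpD =>
    Set.disjoint_left.1 hUD hp ((zpow_mem_iff hD n p).2 hpD))
  have hfin' : ∀ H : C(R, ℤ), (∀ p ∉ W', H p = 0) →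
      ∀ p, (Function.support fun n : ℤ => H ((s ^ n) p)).Finite :=
    fun H hH => hfin H fun p hp => hH p fun h => hW'D h hp
  refine hp₀W (hmax (y := W') ⟨hWo.union (isOpen_iUnion fun n => (hT n).isOpen), hW's, hW'D, ?_⟩
    Set.subset_union_left (Or.inr (Set.mem_iUnion.2 ⟨0, by simpa [T] using hp₀U⟩)))
  intro F hF hsum
  have huniq : ∀ p ∉ W, ∀ m n, p ∈ T m → p ∈ T n → m = n := by
    intro p hp m n hm hn
    have := hwan ((s ^ n) p) hn (by rwa [zpow_mem_iff hWs]) (m - n) (by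
      rw [← zpow_add_apply, sub_add_cancel]
      exact hm)
    omega
  obtain ⟨t, ht⟩ : ∃ t : Finset ℤ, ∀ p, F p ≠ 0 → p ∉ W → ∃ n ∈ t, p ∈ T n := by
    obtain ⟨t, ht⟩ := ((hcpt F).diff hWo).elim_finite_subcover T (fun n => (hT n).isOpen)
      (fun p hp => (by_contra fun h => hp.1 (hF p h) : p ∈ W').resolve_left hp.2)
    refine ⟨t, fun p hp hpW => ?_⟩
    simpa using ht ⟨hp, hpW⟩
  let G (n : ℤ) : C(R, ℤ) := clopenRestrict (hT n) F
  -- The part of `F` on `T n` is transported to `U`, at the cost of a coboundary.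
  let G' (n : ℤ) : C(R, ℤ) := (G n).comp ((s ^ (-n) : R ≃ₜ R) : C(R, R))
  have hcob : IsCoboundaryOn s W' (∑ n ∈ t, (G n - G' n)) :=
    IsCoboundaryOn.sum t fun n _ => isCoboundaryOn_sub_zpow hW's (fun p hp => by
      simp only [G, clopenRestrict_apply, Set.indicator_apply, hF p hp, ite_self]) (-n)
  have hG : ∀ p ∉ W, ∑ n ∈ t, G n p = F p := by
    intro p hp
    by_cases h0 : F p = 0
    · rw [h0]
      exact Finset.sum_eq_zero fun n _ => by
        simp only [G, clopenRestrict_apply, Set.indicator_apply, h0, ite_self]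
    obtain ⟨n, hn, hpn⟩ := ht p h0 hp
    refine (Finset.sum_eq_single_of_mem n hn fun m _ hmn => ?_).trans
      (Set.indicator_of_mem hpn _)
    exact Set.indicator_of_notMem (fun hm => hmn (huniq p hp m n hm hpn)) _
  have hG'_apply : ∀ n p, G' n p = U.indicator (fun q => F ((s ^ (-n)) q)) p := by
    intro n p
    have hmem : (s ^ (-n)) p ∈ T n ↔ p ∈ U := by
      change (s ^ n) ((s ^ (-n)) p) ∈ U ↔ _
      rw [← zpow_add_apply]
      simp
    change (T n).indicator F ((s ^ (-n)) p) = _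
    simp only [Set.indicator_apply, hmem]
  -- At a point of `U` off `W`, the transported parts add up to the sum of `F` along the whole
  -- orbit, which is zero.
  have hG' : ∀ p ∉ W, ∑ n ∈ t, G' n p = 0 := by
    intro p hp
    simp only [hG'_apply]
    by_cases hpU : p ∈ U
    · simp only [Set.indicator_of_mem hpU]
      rw [← hsum p, ← finsum_comp_equiv (Equiv.neg ℤ)]
      refine (finsum_eq_sum_of_support_subset _ fun n hn => ?_).symm
      obtain ⟨m, hm, hmT⟩ := ht ((s ^ (-n)) p) hn (by rwa [zpow_mem_iff hWs])
      have := huniq _ (by rwa [zpow_mem_iff hWs]) m n hmT (by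
        change (s ^ n) ((s ^ (-n)) p) ∈ U
        rw [← zpow_add_apply]
        simpa using hpU)
      exact this ▸ hm
    · simp [hpU]
  -- The corrected function vanishes off `W` and keeps zero orbit sums, so `hPW` applies to it.
  let F' : C(R, ℤ) := F - ∑ n ∈ t, (G n - G' n)
  have hF' : IsCoboundaryOn s W F' := by
    refine hPW F' (fun p hp => ?_) fun p => ?_
    · simp only [F', ContinuousMap.sub_apply, ContinuousMap.sum_apply, Finset.sum_sub_distrib,
        hG p hp, hG' p hp]
      ring
    · have hz : ∀ q ∉ W', (∑ n ∈ t, (G n - G' n)) q = 0 := by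
        intro q hq
        have hq' : q ∉ W := fun h => hq (Or.inl h)
        simp only [ContinuousMap.sub_apply, ContinuousMap.sum_apply, Finset.sum_sub_distrib,
          hG q hq', hG' q hq', hF q hq, sub_zero]
      simp only [F', ContinuousMap.sub_apply]
      rw [finsum_sub_distrib (hfin' F hF p) (hfin' _ hz p), hsum,
        hcob.finsum_eq_zero hfin', sub_zero]
  have := (hF'.mono Set.subset_union_left).add hcob
  rwa [sub_add_cancel] at this

end Cohomology

/-! ### The fibre product and the kernel of the index -/

namespace FactorMap

variable {X Y : DynSys.{u}}

/-- The fibre product of a factor map with itself. -/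
abbrev FibreProduct (π : FactorMap X Y) : Type u :=
  {p : X × X // π.toFun p.1 = π.toFun p.2}

lemma isClosed_fibreProduct (π : FactorMap X Y) :
    IsClosed {p : X × X | π.toFun p.1 = π.toFun p.2} :=
  isClosed_eq (π.toFun.continuous.comp continuous_fst) (π.toFun.continuous.comp continuous_snd)

instance (π : FactorMap X Y) : CompactSpace π.FibreProduct :=
  isCompact_iff_compactSpace.1 π.isClosed_fibreProduct.isCompact

/-- The diagonal action on the fibre product. -/
def fibreMap (π : FactorMap X Y) : π.FibreProduct ≃ₜ π.FibreProduct :=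
  (X.map.prodCongr X.map).subtype fun p => by
    simp [π.equivariant]

lemma fibreMap_zpow_val (π : FactorMap X Y) (n : ℤ) (p : π.FibreProduct) :
    ((π.fibreMap ^ n) p).1 = ((X.map ^ n) p.1.1, (X.map ^ n) p.1.2) := by
  have hs : ∀ q, (π.fibreMap q).1 = (X.map q.1.1, X.map q.1.2) := fun _ => rfl
  induction n with
  | zero => simp
  | succ n ih => simp only [zpow_succ_apply, hs, ih]
  | pred n ih =>
    have h1 := zpow_succ_apply π.fibreMap (-n - 1) p
    have h2 := zpow_succ_apply X.map (-n - 1) p.1.1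
    have h3 := zpow_succ_apply X.map (-n - 1) p.1.2
    rw [sub_add_cancel] at h1 h2 h3
    rw [h1, h2, h3, hs, Prod.mk.injEq] at ih
    exact Prod.ext (X.map.injective ih.1) (X.map.injective ih.2)

/-- The diagonal of the fibre product. -/
def fibreDiagonal (π : FactorMap X Y) : Set π.FibreProduct := {p | p.1.1 = p.1.2}

/-- Exchanging the coordinates of the fibre product. -/
def fibreSwap (π : FactorMap X Y) : C(π.FibreProduct, π.FibreProduct) :=
  ⟨fun p => ⟨(p.1.2, p.1.1), p.2.symm⟩, by fun_prop⟩

lemma equivariant_zpow (π : FactorMap X Y) (n : ℤ) (x : X) :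
    π.toFun ((X.map ^ n) x) = (Y.map ^ n) (π.toFun x) := by
  induction n with
  | zero => simp
  | succ n ih => rw [zpow_succ_apply, zpow_succ_apply, π.equivariant, ih]
  | pred n ih =>
    apply Y.map.injective
    rw [← π.equivariant, ← zpow_succ_apply, ← zpow_succ_apply, sub_add_cancel, ih]

namespace IsTwoAsymptotic

variable {π : FactorMap X Y}

lemma mem_blownUp {x x' : X} (h : π.toFun x = π.toFun x') (hne : x ≠ x') :
    π.toFun x ∈ π.blownUp :=
  Set.one_lt_encard_iff.2 ⟨x, x', rfl, h.symm, hne⟩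

lemma asymptotic (hπ : π.IsTwoAsymptotic) {x x' : X} (h : π.toFun x = π.toFun x') (hne : x ≠ x') :
    X.Asymptotic x x' :=
  (hπ _ (mem_blownUp h hne)).2 x rfl x' h.symm

/-- The orbits off the diagonal of the fibre product are dissipative. -/
lemma finite_support_fibre (hπ : π.IsTwoAsymptotic) (H : C(π.FibreProduct, ℤ))
    (hH : ∀ p ∈ π.fibreDiagonal, H p = 0) (p : π.FibreProduct) :
    (Function.support fun n : ℤ => H ((π.fibreMap ^ n) p)).Finite := by
  by_cases hp : p.1.1 = p.1.2
  · convert Set.finite_empty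
    refine Function.support_eq_empty_iff.2 (funext fun n => hH _ ?_)
    change ((π.fibreMap ^ n) p).1.1 = ((π.fibreMap ^ n) p).1.2
    rw [fibreMap_zpow_val, hp]
  have has := hπ.asymptotic p.2 hp
  have hK : IsCompact {q | H q ≠ 0} :=
    ((isClopen_discrete {0}ᶜ).preimage H.continuous).isClosed.isCompact
  -- The support of `H` is compact and misses the diagonal, so it stays at positive distance from
  -- it.
  obtain ⟨δ, hδ, hd⟩ : ∃ δ > 0, ∀ q, H q ≠ 0 → δ ≤ dist q.1.1 q.1.2 := by
    rcases Set.eq_empty_or_nonempty {q | H q ≠ 0} with he | hne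
    · exact ⟨1, one_pos, fun q hq => ((Set.eq_empty_iff_forall_notMem.1 he) q hq).elim⟩
    · obtain ⟨q, hq, hmin⟩ := hK.exists_isMinOn hne
        (f := fun q : π.FibreProduct => dist q.1.1 q.1.2) (by fun_prop)
      exact ⟨_, dist_pos.2 fun h => hq (hH q h), fun r hr => hmin hr⟩
  obtain ⟨a, ha⟩ := eventually_atBot.1 (has.1.eventually (gt_mem_nhds hδ))
  obtain ⟨b, hb⟩ := eventually_atTop.1 (has.2.eventually (gt_mem_nhds hδ))
  refine (Set.finite_Icc a b).subset fun n hn => ?_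
  have h1 := hd _ hn
  rw [fibreMap_zpow_val] at h1
  by_contra hcon
  rw [Set.mem_Icc, not_and_or, not_le, not_le] at hcon
  rcases hcon with hcon | hcon
  · exact (ha n hcon.le).not_ge h1
  · exact (hb n hcon.le).not_ge h1

/-- If all indices of `f` vanish, then so do those of all pairs in the fibre product. -/
lemma finsum_eq_zero_of_index_eq_zero (hπ : π.IsTwoAsymptotic) {f : C(X, ℤ)}
    (hf : hπ.index (X.cls f) = 0) {x x' : X} (h : π.toFun x = π.toFun x') :
    ∑ᶠ n : ℤ, (f ((X.map ^ n) x) - f ((X.map ^ n) x')) = 0 := by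
  by_cases hne : x = x'
  · simp [hne]
  let o : π.BlownUpOrbits := ⟦⟨π.toFun x, mem_blownUp h hne⟩⟧
  have hfib := (hπ.exists_pair o).choose_spec.2
  obtain ⟨m, hm⟩ : ∃ m : ℤ, (Y.map ^ m) (Quotient.out o).1 = π.toFun x :=
    Quotient.mk_out (s := Y.orbitSetoid.comap (Subtype.val : π.blownUp → Y)) _
  have hsum : ∑ᶠ n : ℤ, (f ((X.map ^ n) (hπ.pair o).1) - f ((X.map ^ n) (hπ.pair o).2)) = 0 :=
    congrFun hf o
  have hmem : ∀ z, π.toFun z = π.toFun x →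
      z = (X.map ^ m) (hπ.pair o).1 ∨ z = (X.map ^ m) (hπ.pair o).2 := by
    intro z hz
    have hz' : (X.map ^ (-m)) z ∈ π.fiber (Quotient.out o).1 := by
      change π.toFun _ = _
      rw [equivariant_zpow, hz, ← hm, ← zpow_add_apply]
      simp
    have hback : (X.map ^ m) ((X.map ^ (-m)) z) = z := by
      rw [← zpow_add_apply]
      simp
    rw [hfib] at hz'
    rcases hz' with h1 | h1
    · exact Or.inl (hback.symm.trans (congrArg _ h1))
    · exact Or.inr (hback.symm.trans (congrArg _ h1))
  have hshift : ∑ᶠ n : ℤ, (f ((X.map ^ n) ((X.map ^ m) (hπ.pair o).1)) -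
      f ((X.map ^ n) ((X.map ^ m) (hπ.pair o).2))) = 0 := by
    simp only [← zpow_add_apply]
    exact (finsum_comp_equiv (f := fun n : ℤ => f ((X.map ^ n) (hπ.pair o).1) -
      f ((X.map ^ n) (hπ.pair o).2)) (Equiv.addRight m)).trans hsum
  have hshift' : ∑ᶠ n : ℤ, (f ((X.map ^ n) ((X.map ^ m) (hπ.pair o).2)) -
      f ((X.map ^ n) ((X.map ^ m) (hπ.pair o).1))) = 0 := by
    rw [← neg_eq_zero, ← finsum_neg_distrib]
    simpa only [neg_sub] using hshift
  rcases hmem x rfl with h1 | h1 <;> rcases hmem x' h.symm with h2 | h2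
  · exact (hne (h1.trans h2.symm)).elim
  · rw [h1, h2]; exact hshift
  · rw [h1, h2]; exact hshift'
  · exact (hne (h1.trans h2.symm)).elim

end IsTwoAsymptotic

/-- A function on the fibre product whose restriction to each fibre is a difference is globally
a difference. -/
lemma exists_difference (π : FactorMap X Y) (hY : Y.IsZeroDim) (H : C(π.FibreProduct, ℤ))
    (hloc : ∀ y : Y, ∃ h : C(X, ℤ), ∀ p : π.FibreProduct, π.toFun p.1.1 = y →
      H p = h p.1.1 - h p.1.2) :
    ∃ h : C(X, ℤ), ∀ p : π.FibreProduct, H p = h p.1.1 - h p.1.2 := by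
  let Q (s : Set Y) : Prop := ∃ V : Set Y, IsClopen V ∧ s ⊆ V ∧ ∃ h : C(X, ℤ),
    ∀ p : π.FibreProduct, π.toFun p.1.1 ∈ V → H p = h p.1.1 - h p.1.2
  obtain ⟨V, -, hV, h, hh⟩ : Q Set.univ := by
    refine isCompact_univ.induction_on (p := Q) ⟨∅, isClopen_empty, le_rfl, 0, by simp⟩
      (fun s t hst ⟨V, hV, htV, h⟩ => ⟨V, hV, hst.trans htV, h⟩) ?_ ?_
    · rintro s t ⟨V, hV, hsV, h, hh⟩ ⟨V', hV', htV', h', hh'⟩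
      have hP := hV.preimage π.toFun.continuous
      -- Both points of a pair lie over the same point of `Y`, hence on the same side of the cut, so
      -- local solutions can be glued.
      refine ⟨V ∪ V', hV.union hV', Set.union_subset_union hsV htV',
        clopenRestrict hP h + clopenRestrict hP.compl h', fun p hp => ?_⟩
      by_cases hpV : π.toFun p.1.1 ∈ V
      · have hpV' := hpV
        rw [p.2] at hpV'
        simp [clopenRestrict_apply, hpV, hpV', hh p hpV]
      · have hpV' := hpV
        rw [p.2] at hpV'
        simp [clopenRestrict_apply, hpV, hpV', hh' p (hp.resolve_left hpV)]
    · intro y _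
      obtain ⟨h, hh⟩ := hloc y
      have hcont : Continuous fun p : π.FibreProduct => H p - (h p.1.1 - h p.1.2) := by fun_prop
      -- The pairs where `h` fails form a compact set whose image in `Y` misses `y`; a clopen
      -- neighbourhood of `y` avoids that image.
      have hbad : IsClosed {p : π.FibreProduct | H p - (h p.1.1 - h p.1.2) ≠ 0} :=
        ((isClopen_discrete {0}ᶜ).preimage hcont).isClosed
      have him : IsClosed ((fun p : π.FibreProduct => π.toFun p.1.1) ''
          {p : π.FibreProduct | H p - (h p.1.1 - h p.1.2) ≠ 0}) :=
        (hbad.isCompact.image (by fun_prop)).isClosed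
      obtain ⟨V, hV, hyV, hVsub⟩ := hY.mem_nhds_iff.1 (him.isOpen_compl.mem_nhds (x := y) (by
        rintro ⟨p, hp, rfl⟩
        exact hp (sub_eq_zero.2 (hh p rfl))))
      refine ⟨V, mem_nhdsWithin_of_mem_nhds (hV.isOpen.mem_nhds hyV), V, hV, le_rfl, h,
        fun p hp => by_contra fun hne => ?_⟩
      exact hVsub hp ⟨p, fun h0 => hne (sub_eq_zero.1 h0), rfl⟩
  exact ⟨h, fun p => hh p (hV trivial)⟩

/-- A function that is constant on the fibres of a factor map comes from the factor. -/
lemma exists_descend (π : FactorMap X Y) (f : C(X, ℤ))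
    (hf : ∀ x x', π.toFun x = π.toFun x' → f x = f x') : ∃ g : C(Y, ℤ), g.comp π.toFun = f := by
  have hq : IsQuotientMap π.toFun :=
    π.toFun.continuous.isClosedMap.isQuotientMap π.toFun.continuous π.surjective
  exact ⟨hq.lift f hf, hq.lift_comp f hf⟩

/-- An antisymmetric function on the fibre product is a difference on each fibre. -/
lemma IsTwoAsymptotic.exists_difference_on_fibre {π : FactorMap X Y} (hπ : π.IsTwoAsymptotic)
    (hX : X.IsZeroDim) (H : C(π.FibreProduct, ℤ)) (h0 : ∀ p ∈ π.fibreDiagonal, H p = 0)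
    (hanti : ∀ p, H p + H (π.fibreSwap p) = 0) (y : Y) :
    ∃ h : C(X, ℤ), ∀ p : π.FibreProduct, π.toFun p.1.1 = y → H p = h p.1.1 - h p.1.2 := by
  by_cases hy : ∃ p : π.FibreProduct, π.toFun p.1.1 = y ∧ p.1.1 ≠ p.1.2
  · obtain ⟨p, rfl, hne⟩ := hy
    obtain ⟨A, hA, hpA, hAsub⟩ := hX.mem_nhds_iff.1
      (isOpen_compl_singleton.mem_nhds (show p.1.1 ∈ ({p.1.2}ᶜ : Set X) from hne))
    -- The fibre has just two points, so prescribing `h` there settles the pair `p`, and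
    -- antisymmetry settles its swap.
    obtain ⟨h, h1, h2⟩ : ∃ h : C(X, ℤ), h p.1.1 = H p ∧ h p.1.2 = 0 :=
      ⟨clopenRestrict hA (ContinuousMap.const X (H p)), Set.indicator_of_mem hpA _,
        Set.indicator_of_notMem (fun hp => hAsub hp rfl) _⟩
    refine ⟨h, fun q hq => ?_⟩
    have hfib : ∀ z, π.toFun z = π.toFun p.1.1 → z = p.1.1 ∨ z = p.1.2 := by
      obtain ⟨a, b, -, hab⟩ := Set.encard_eq_two.1 (hπ _ (mem_blownUp p.2 hne)).1
      have m1 : p.1.1 ∈ π.fiber (π.toFun p.1.1) := rfl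
      have m2 : p.1.2 ∈ π.fiber (π.toFun p.1.1) := p.2.symm
      intro z hz
      have m3 : z ∈ π.fiber (π.toFun p.1.1) := hz
      rw [hab] at m1 m2 m3
      simp only [Set.mem_insert_iff, Set.mem_singleton_iff] at m1 m2 m3
      grind
    rcases hfib q.1.1 hq with e1 | e1 <;> rcases hfib q.1.2 (q.2.symm.trans hq) with e2 | e2
    · rw [h0 q (e1.trans e2.symm), e1, e2, sub_self]
    · obtain rfl : q = p := Subtype.ext (Prod.ext e1 e2)
      rw [h1, h2, sub_zero]
    · obtain rfl : q = π.fibreSwap p := Subtype.ext (Prod.ext e1 e2)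
      rw [e1, e2, h1, h2]
      have := hanti p
      linarith
    · rw [h0 q (e1.trans e2.symm), e1, e2, sub_self]
  · push Not at hy
    exact ⟨0, fun p hp => by simpa using h0 p (hy p hp)⟩

/-- The kernel of the index homomorphism consists of the classes coming from the factor. -/
theorem IsTwoAsymptotic.exists_pullback_eq {π : FactorMap X Y} (hπ : π.IsTwoAsymptotic)
    (hX : X.IsZeroDim) (hY : Y.IsZeroDim) {c : X.Coinv} (hc : hπ.index c = 0) :
    ∃ d : Y.Coinv, π.pullback d = c := by
  obtain ⟨f, rfl⟩ := QuotientAddGroup.mk_surjective c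
  have := hX.totallySeparatedSpace
  have : TotallyDisconnectedSpace X := inferInstance
  have hdiag : ∀ p, π.fibreMap p ∈ π.fibreDiagonal ↔ p ∈ π.fibreDiagonal := fun p =>
    X.map.injective.eq_iff
  let F : C(π.FibreProduct, ℤ) := ⟨fun p => f p.1.1 - f p.1.2, by fun_prop⟩
  have hF : ∀ p, F p = f p.1.1 - f p.1.2 := fun _ => rfl
  obtain ⟨H, h0, hH⟩ := isCoboundaryOn_of_finsum_eq_zero π.fibreMap (D := π.fibreDiagonal)
    (isClosed_eq (by fun_prop) (by fun_prop)) hdiag hπ.finite_support_fibre F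
    (fun p hp => by rw [hF, show p.1.1 = p.1.2 from hp, sub_self])
    (fun p => by
      simp only [hF, fibreMap_zpow_val]
      exact hπ.finsum_eq_zero_of_index_eq_zero hc p.2)
  simp only [Set.mem_compl_iff, not_not] at h0
  -- `F` is antisymmetric, so the symmetrization of `H` is invariant. It vanishes on the diagonal,
  -- so it has finite support along every orbit; being constant there, it is zero.
  have hanti : ∀ p, H p + H (π.fibreSwap p) = 0 := by
    let E : C(π.FibreProduct, ℤ) := H + H.comp π.fibreSwap
    have hE : ∀ p, E (π.fibreMap p) = E p := by
      intro p
      have h1 := hH p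
      have h2 := hH (π.fibreSwap p)
      have h3 : F (π.fibreSwap p) = -F p := (neg_sub _ _).symm
      change H (π.fibreMap p) + H (π.fibreMap (π.fibreSwap p)) = H p + H (π.fibreSwap p)
      linarith
    intro p
    by_contra hne
    have hconst : ∀ n : ℤ, (π.fibreMap ^ n) p ∈ {q | E q ≠ 0} := fun n =>
      (zpow_mem_iff (W := {q | E q ≠ 0}) (fun q => by simp [hE]) n p).2 hne
    have hfin := hπ.finite_support_fibre E (fun q hq => by
      change H q + H (π.fibreSwap q) = 0
      rw [h0 q hq, h0 _ (show π.fibreSwap q ∈ π.fibreDiagonal from Eq.symm hq), add_zero]) p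
    exact Set.infinite_univ (α := ℤ) (hfin.subset fun n _ => hconst n)
  obtain ⟨h, hh⟩ := π.exists_difference hY H (hπ.exists_difference_on_fibre hX H h0 hanti)
  obtain ⟨g, hg⟩ := π.exists_descend (f - X.coboundary h) fun x x' hxx' => by
    have e1 := hH ⟨(x, x'), hxx'⟩
    rw [hh, hh, hF] at e1
    change f x - f x' = h x - h x' - (h (X.map x) - h (X.map x')) at e1
    change f x - (h x - h (X.map x)) = f x' - (h x' - h (X.map x'))
    linarith
  refine ⟨Y.cls g, ?_⟩
  rw [pullback_cls, hg]
  exact QuotientAddGroup.eq.2 ⟨h, by abel⟩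

end FactorMap

/-! ### States and rational images under 2-AI factor maps -/

namespace FactorMap

variable {X Y : DynSys.{u}} {π : FactorMap X Y}

/-- A factor map is infinitesimal if every index has a nonzero multiple in the image of the
infinitesimals. -/
lemma IsTwoAsymptotic.isInfinitesimal_iff (hπ : π.IsTwoAsymptotic) :
    hπ.IsInfinitesimal ↔ ∀ c : X.Coinv, ∃ m : ℕ, 0 < m ∧ ∃ i ∈ X.infinitesimals,
      hπ.index i = m • hπ.index c := by
  have key : ∀ (c : X.Coinv) (m : ℕ),
      (m • (QuotientAddGroup.mk (⟨hπ.index c, c, rfl⟩ : hπ.index.range) :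
        hπ.index.range ⧸ (X.infinitesimals.map hπ.index).addSubgroupOf hπ.index.range) = 0) ↔
      ∃ i ∈ X.infinitesimals, hπ.index i = m • hπ.index c := by
    intro c m
    rw [← QuotientAddGroup.mk_nsmul, QuotientAddGroup.eq_zero_iff, AddSubgroup.mem_addSubgroupOf]
    rfl
  constructor
  · intro h c
    obtain ⟨m, hm, h0⟩ := isOfFinAddOrder_iff_nsmul_eq_zero.1
      (h (QuotientAddGroup.mk ⟨hπ.index c, c, rfl⟩))
    exact ⟨m, hm, (key c m).1 h0⟩
  · intro h q
    obtain ⟨⟨_, c, rfl⟩, rfl⟩ := QuotientAddGroup.mk_surjective q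
    obtain ⟨m, hm, h0⟩ := h c
    exact isOfFinAddOrder_iff_nsmul_eq_zero.2 ⟨m, hm, (key c m).2 h0⟩

lemma IsTwoAsymptotic.index_pullback (hπ : π.IsTwoAsymptotic) (d : Y.Coinv) :
    hπ.index (π.pullback d) = 0 := by
  obtain ⟨g, rfl⟩ := QuotientAddGroup.mk_surjective d
  funext o
  have hpair := (hπ.exists_pair o).choose_spec.2
  have h1 : (hπ.pair o).1 ∈ π.fiber (Quotient.out o).1 := by rw [hpair]; simp [pair]
  have h2 : (hπ.pair o).2 ∈ π.fiber (Quotient.out o).1 := by rw [hpair]; simp [pair]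
  have h : π.toFun (hπ.pair o).1 = π.toFun (hπ.pair o).2 := Eq.trans h1 (Eq.symm h2)
  change ∑ᶠ n : ℤ, (g (π.toFun ((X.map ^ n) _)) - g (π.toFun ((X.map ^ n) _))) = 0
  simp [equivariant_zpow, h]

/-- Up to multiples and infinitesimals, every class comes from a 2-AI factor. -/
lemma IsTwoAI.exists_nsmul_eq (hπ : π.IsTwoAI) (hX : X.IsZeroDim) (hY : Y.IsZeroDim)
    (c : X.Coinv) : ∃ m : ℕ, 0 < m ∧ ∃ d : Y.Coinv, ∀ τ : X.Coinv →+ ℝ, X.IsState τ →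
      (m : ℝ) * τ c = τ.comp π.pullback d := by
  obtain ⟨h2, hinf⟩ := hπ
  obtain ⟨m, hm, i, hi, hic⟩ := h2.isInfinitesimal_iff.1 hinf c
  obtain ⟨d, hd⟩ := h2.exists_pullback_eq hX hY (c := m • c - i) (by
    rw [map_sub, map_nsmul, hic, sub_self])
  refine ⟨m, hm, d, fun τ hτ => ?_⟩
  have hτi : τ i = 0 := AddSubgroup.mem_iInf.1 hi ⟨τ, hτ⟩
  rw [AddMonoidHom.comp_apply, hd, map_sub, hτi, map_nsmul, nsmul_eq_mul, sub_zero]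

/-- A positive multiple of each class is pulled back up to an infinitesimal, and `ℝ` is
torsion-free, so a state is determined by its restriction to the factor. -/
lemma IsTwoAI.state_ext (hπ : π.IsTwoAI) (hX : X.IsZeroDim) (hY : Y.IsZeroDim)
    {τ τ' : X.Coinv →+ ℝ} (hτ : X.IsState τ) (hτ' : X.IsState τ')
    (h : τ.comp π.pullback = τ'.comp π.pullback) : τ = τ' := by
  refine DFunLike.ext _ _ fun c => ?_
  obtain ⟨m, hm, d, hd⟩ := hπ.exists_nsmul_eq hX hY c
  have := (hd τ hτ).trans ((DFunLike.congr_fun h d).trans (hd τ' hτ').symm)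
  exact mul_left_cancel₀ (by positivity) this

lemma IsTwoAI.ratImage_eq (hπ : π.IsTwoAI) (hX : X.IsZeroDim) (hY : Y.IsZeroDim)
    {τ : X.Coinv →+ ℝ} (hτ : X.IsState τ) :
    X.ratImage τ = Y.ratImage (τ.comp π.pullback) := by
  refine le_antisymm (Submodule.span_le.2 ?_) (Submodule.span_mono ?_)
  · rintro _ ⟨c, rfl⟩
    obtain ⟨m, hm, d, hd⟩ := hπ.exists_nsmul_eq hX hY c
    have : τ c = (m : ℚ)⁻¹ • τ.comp π.pullback d := by
      rw [← hd τ hτ, Rat.smul_def]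
      push_cast
      field_simp
    rw [this]
    exact Submodule.smul_mem _ _ (Submodule.subset_span ⟨d, rfl⟩)
  · rintro _ ⟨d, rfl⟩
    exact ⟨π.pullback d, rfl⟩

end FactorMap

/-- The elements of the rational span of a subgroup of the reals have nonzero multiples in it. -/
lemma exists_nsmul_mem_of_mem_span {A : Type*} [AddCommGroup A] (τ : A →+ ℝ) {r : ℝ}
    (hr : r ∈ Submodule.span ℚ (Set.range τ)) : ∃ m : ℕ, 0 < m ∧ ∃ a, τ a = m • r := by
  induction hr using Submodule.span_induction with
  | mem r hr =>
    obtain ⟨a, rfl⟩ := hr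
    exact ⟨1, one_pos, a, by simp⟩
  | zero => exact ⟨1, one_pos, 0, by simp⟩
  | add r r' _ _ ih ih' =>
    obtain ⟨m, hm, a, ha⟩ := ih
    obtain ⟨m', hm', a', ha'⟩ := ih'
    refine ⟨m * m', by positivity, m' • a + m • a', ?_⟩
    rw [map_add, map_nsmul, map_nsmul, ha, ha']
    simp only [nsmul_eq_mul]
    push_cast
    ring
  | smul q r _ ih =>
    obtain ⟨m, hm, a, ha⟩ := ih
    -- The factor `q.den` clears the denominator of `q`, leaving the integer multiple `q.num • a`.
    refine ⟨m * q.den, by positivity, q.num • a, ?_⟩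
    rw [map_zsmul, ha, Rat.smul_def]
    simp only [nsmul_eq_mul, zsmul_eq_mul]
    have hq : (q : ℝ) * q.den = q.num := by exact_mod_cast Rat.mul_den_eq_num q
    rw [← hq]
    push_cast
    ring

/-! ### Invariance under 2-AI equivalence -/

namespace DynSys

/-- The system is zero-dimensional with exactly one state, whose image has rational span `V`. -/
def HasUniqueState (X : DynSys.{u}) (V : Submodule ℚ ℝ) : Prop :=
  X.IsZeroDim ∧ ∃ τ, X.IsState τ ∧ (∀ τ', X.IsState τ' → τ' = τ) ∧ X.ratImage τ = V

/-- States of `Y₂` lift to `X`, and any two states of `X` agree because their restrictions to `Y₁`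
do. The rational image is carried up to `X` and down again by `ratImage_eq`. -/
lemma ElemTwoAIEquiv.hasUniqueState {Y₁ Y₂ : DynSys.{u}} (h : ElemTwoAIEquiv Y₁ Y₂)
    {V : Submodule ℚ ℝ} (h₁ : Y₁.HasUniqueState V) : Y₂.HasUniqueState V := by
  obtain ⟨hY₁, hY₂, X, hX, ⟨π₁, hπ₁⟩, ⟨π₂, hπ₂⟩⟩ := h
  obtain ⟨-, σ, hσ, huniq, hV⟩ := h₁
  obtain ⟨τ, hτ, hτσ⟩ := π₁.exists_state_lift hσ
  refine ⟨hY₂, τ.comp π₂.pullback, π₂.isState_comp_pullback hτ, fun σ₂ hσ₂ => ?_, ?_⟩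
  · obtain ⟨τ', hτ', rfl⟩ := π₂.exists_state_lift hσ₂
    rw [hπ₁.state_ext hX hY₁ hτ' hτ]
    rw [hτσ]
    exact huniq _ (π₁.isState_comp_pullback hτ')
  · rw [← hπ₂.ratImage_eq hX hY₂ hτ, hπ₁.ratImage_eq hX hY₁ hτ, hτσ, hV]

lemma TwoAIEquiv.hasUniqueState {Y₁ Y₂ : DynSys.{u}} (h : TwoAIEquiv Y₁ Y₂)
    {V : Submodule ℚ ℝ} (h₁ : Y₁.HasUniqueState V) : Y₂.HasUniqueState V := by
  induction h with
  | single h => exact h.hasUniqueState h₁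
  | tail _ h ih => exact h.hasUniqueState ih

end DynSys

end

theorem mainTheorem7 (X Y : DynSys.{u})
    (hXC : X.IsCantor) (hXm : X.IsMinimal) (hXe : X.IsUniquelyErgodic)
    (hYC : Y.IsCantor) (hYm : Y.IsMinimal) (hYe : Y.IsUniquelyErgodic)
    (τX : X.Coinv →+ ℝ) (hτX : X.IsState τX)
    (τY : Y.Coinv →+ ℝ) (hτY : Y.IsState τY) :
    ((∃ π : FactorMap X Y, π.IsTwoAI) → X.ratImage τX = Y.ratImage τY) ∧
    (X.ratImage τX = Y.ratImage τY →
      ∀ (π : FactorMap X Y) (hπ : π.IsTwoAsymptotic), hπ.IsInfinitesimal) ∧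
    (X.TwoAIEquiv Y → X.ratImage τX = Y.ratImage τY) := by
  have hX := hXC.isZeroDim
  have hY := hYC.isZeroDim
  have hτ : ∀ π : FactorMap X Y, τX.comp π.pullback = τY := fun π =>
    hYe.state_unique hY (π.isState_comp_pullback hτX) hτY
  refine ⟨fun ⟨π, hπ⟩ => ?_, fun himg π hπ => ?_, fun h => ?_⟩
  · rw [hπ.ratImage_eq hX hY hτX, hτ]
  · refine hπ.isInfinitesimal_iff.2 fun c => ?_
    obtain ⟨m, hm, d, hd⟩ := exists_nsmul_mem_of_mem_span τY
      (show τX c ∈ Y.ratImage τY from himg ▸ Submodule.subset_span ⟨c, rfl⟩)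
    -- Subtracting `π.pullback d` makes the only state vanish and leaves the index unchanged.
    refine ⟨m, hm, m • c - π.pullback d, AddSubgroup.mem_iInf.2 fun τ => ?_, ?_⟩
    · rw [hXe.state_unique hX τ.2 hτX, AddMonoidHom.mem_ker, map_sub, map_nsmul, ← hd, ← hτ π]
      exact sub_self _
    · rw [map_sub, map_nsmul, hπ.index_pullback, sub_zero]
  · obtain ⟨-, τ, -, huniq, hV⟩ := h.hasUniqueState (V := X.ratImage τX)
      ⟨hX, τX, hτX, fun τ' hτ' => hXe.state_unique hX hτ' hτX, rfl⟩
    rw [← hV, huniq τY hτY]
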